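/- Let $d\ge 0$, let $(\mu_k)_{k\in\mathbb Z}$ be a bi-sequence of Borel probability measures on $\mathbb R^d$ and let $\phi$ be an invertible linear map of $\mathbb R^d$. For a Borel probability measure $\rho$ on $\mathbb R^d$ and $j\in\mathbb Z$ let $\phi^j(\rho)$ denote the image of $\rho$ under $\phi^j$, and let $*$ denote convolution. A solution of the equation $$\lambda_k=\mu_k*\phi(\lambda_{k-1}),\qquad k\in\mathbb Z, \tag{1}$$ is a bi-sequence $(\lambda_k)_{k\in\mathbb Z}$ of Borel probability measures on $\mathbb R^d$ that satisfies it for all $k\in\mathbb Z$. A solution $(\lambda_k)$ is called fundamental if for every solution $(\nu_k)$ of (1) there is a Borel probability measure $\nu$ on $\mathbb R^d$ such that $\nu_k=\lambda_k*\phi^k(\nu)$ for all $k\in\mathbb Z$. A Borel probability measure $\rho$ on $\mathbb R^d$ is called infinitely divisible if for every integer $n\ge 1$ there is a Borel probability measure $\rho_n$ on $\mathbb R^d$ whose $n$-fold convolution power is $\rho$. Suppose that each $\mu_k$, $k\in\mathbb Z$, is infinitely divisible, and let $(\lambda_k)$ be a fundamental solution of (1). Then each $\lambda_k$, $k\in\mathbb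 Z$, is infinitely divisible. -/

import Mathlib

open MeasureTheory

/-- The `n`-fold convolution power `ρ * ⋯ * ρ` of a measure (with `ρ` to the power `0` equal to
the Dirac measure at `0`). -/
noncomputable def convPow {d : ℕ} (ρ : Measure (EuclideanSpace ℝ (Fin d))) :
    ℕ → Measure (EuclideanSpace ℝ (Fin d))
  | 0 => Measure.dirac 0
  | n + 1 => Measure.conv (convPow ρ n) ρ

/-- A Borel probability measure on `ℝ^d` is infinitely divisible if for every `n ≥ 1` it is the
`n`-fold convolution power of some Borel probability measure on `ℝ^d`. -/
def IsInfinitelyDivisible {d : ℕ} (ρ : Measure (EuclideanSpace ℝ (Fin d))) : Prop :=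
  IsProbabilityMeasure ρ ∧
    ∀ n : ℕ, 1 ≤ n → ∃ σ : Measure (EuclideanSpace ℝ (Fin d)),
      IsProbabilityMeasure σ ∧ convPow σ n = ρ

/-- `lam` is a bi-sequence of probability measures with `lam k = μ k * φ (lam (k - 1))` for all
integers `k`, where `φ` acts on measures by push-forward. -/
def IsConvSolution {d : ℕ} (μ : ℤ → Measure (EuclideanSpace ℝ (Fin d)))
    (φ : EuclideanSpace ℝ (Fin d) ≃ₗ[ℝ] EuclideanSpace ℝ (Fin d))
    (lam : ℤ → Measure (EuclideanSpace ℝ (Fin d))) : Prop :=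
  (∀ k : ℤ, IsProbabilityMeasure (lam k)) ∧
    ∀ k : ℤ, lam k = Measure.conv (μ k) ((lam (k - 1)).map φ)

/-- A solution `lam` is fundamental if every solution `ν` is of the form
`ν k = lam k * φ ^ k (ρ)`, for all integers `k`, with a single probability measure `ρ`.
Here `φ ^ k` is the integer power in the group of linear automorphisms. -/
def IsFundamentalSolution {d : ℕ} (μ : ℤ → Measure (EuclideanSpace ℝ (Fin d)))
    (φ : EuclideanSpace ℝ (Fin d) ≃ₗ[ℝ] EuclideanSpace ℝ (Fin d))
    (lam : ℤ → Measure (EuclideanSpace ℝ (Fin d))) : Prop :=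
  IsConvSolution μ φ lam ∧
    ∀ ν : ℤ → Measure (EuclideanSpace ℝ (Fin d)), IsConvSolution μ φ ν →
      ∃ ρ : Measure (EuclideanSpace ℝ (Fin d)), IsProbabilityMeasure ρ ∧
        ∀ k : ℤ, ν k = Measure.conv (lam k) (ρ.map (φ ^ k))

open Filter Topology
open scoped ENNReal RealInnerProductSpace

/-! ### Tightness and cancellation for convolutions -/

section Convolution

/-! Replacing `lam k` by its image under `φ ^ (-k)` removes `φ`: now `lam k = η k ∗ lam (k - 1)`,
and every solution is `lam k ∗ ρ` with one `ρ`. Iterating, `lam k` is a finite product `P k m` of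
`η`'s convolved with `lam (-m)`. After shifts independent of `k`, both factors are tight, so along
an ultrafilter in `m` they converge to `π k` and `κ`. Then `π` is a solution, each `π k` is
infinitely divisible as a limit of such measures, and `lam k = π k ∗ κ`. Fundamentality gives `π k =
lam k ∗ ν`, so `lam k ∗ (κ ∗ ν) = lam k`. This forces `κ ∗ ν` to be the Dirac mass at `0`, hence `ν`
is a point mass and `lam k` is a translate of `π k`. -/

theorem measurableSet_norm_gt {E : Type*} [NormedAddCommGroup E] [MeasurableSpace E]
    [BorelSpace E] (R : ℝ) : MeasurableSet {x : E | R < ‖x‖} :=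
  measurableSet_lt measurable_const measurable_norm

/-- A family of measures is tight iff its mass outside large balls is uniformly small. -/
theorem isTightMeasureSet_range_iff {E : Type*} [NormedAddCommGroup E]
    [InnerProductSpace ℝ E] [FiniteDimensional ℝ E] [MeasurableSpace E] {ι : Type*} {A : ι → Measure E} :
    IsTightMeasureSet (Set.range A) ↔
      ∀ ε : ℝ≥0∞, 0 < ε → ∃ R : ℝ, ∀ i, A i {x | R < ‖x‖} ≤ ε := by
  have : ProperSpace E := FiniteDimensional.proper ℝ E
  rw [isTightMeasureSet_iff_tendsto_measure_norm_gt, ENNReal.tendsto_atTop_zero]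
  simp only [iSup_range, iSup_le_iff]
  refine forall₂_congr fun ε _ => ⟨fun ⟨R, hR⟩ => ⟨R, hR R le_rfl⟩, fun ⟨R, hR⟩ => ⟨R, fun r hr i =>
    (measure_mono fun x (hx : r < ‖x‖) => hr.trans_lt hx).trans (hR i)⟩⟩

variable {E : Type*} [NormedAddCommGroup E] [InnerProductSpace ℝ E] [FiniteDimensional ℝ E]
  [MeasurableSpace E] [BorelSpace E]

/-- The convolution of two measures gives a sumset at least the product of the masses. -/
theorem mul_le_conv_apply {μ ν : Measure E} [SFinite μ] [SFinite ν] {s t u : Set E}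
    (hu : MeasurableSet u) (h : ∀ x ∈ s, ∀ y ∈ t, x + y ∈ u) :
    μ s * ν t ≤ (μ ∗ ν) u := by
  rw [Measure.conv, Measure.map_apply measurable_add hu, ← Measure.prod_prod]
  exact measure_mono fun z hz => h _ hz.1 _ hz.2

/-- If the convolutions and the left factors are tight, then so are the right factors. -/
theorem IsTightMeasureSet.right_of_conv {ι : Type*} {A B : ι → Measure E}
    [∀ i, IsProbabilityMeasure (A i)] [∀ i, IsProbabilityMeasure (B i)]
    (hA : IsTightMeasureSet (Set.range A))
    (hAB : IsTightMeasureSet (Set.range fun i => A i ∗ B i)) :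
    IsTightMeasureSet (Set.range B) := by
  rw [isTightMeasureSet_range_iff] at *
  intro ε hε
  -- The left factor keeps mass at least 1/2 in the ball of radius `R`, so half of any far tail of
  -- `B i` survives in the convolution.
  obtain ⟨R, hR⟩ := hA 2⁻¹ (by simp)
  obtain ⟨S, hS⟩ := hAB (2⁻¹ * ε) (ENNReal.mul_pos (by simp) hε.ne')
  refine ⟨R + S, fun i => ?_⟩
  have h1 : (2⁻¹ : ℝ≥0∞) ≤ A i {x | R < ‖x‖}ᶜ := by
    rw [prob_compl_eq_one_sub (measurableSet_norm_gt R)]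
    calc (2⁻¹ : ℝ≥0∞) = 1 - 2⁻¹ := ENNReal.one_sub_inv_two.symm
      _ ≤ _ := tsub_le_tsub_left (hR i) 1
  have h2 : A i {x | R < ‖x‖}ᶜ * B i {x | R + S < ‖x‖} ≤ (A i ∗ B i) {x | S < ‖x‖} := by
    refine mul_le_conv_apply (measurableSet_norm_gt S) fun x hx y hy => ?_
    simp only [Set.mem_compl_iff, Set.mem_ofPred_eq, not_lt] at hx hy ⊢
    have : ‖y‖ ≤ ‖x + y‖ + ‖x‖ := by
      simpa using norm_sub_le (x + y) x
    linarith
  have h3 : (2⁻¹ : ℝ≥0∞) * B i {x | R + S < ‖x‖} ≤ 2⁻¹ * ε :=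
    (mul_le_mul_left h1 _).trans (h2.trans (hS i))
  exact (ENNReal.mul_le_mul_iff_right (by simp) (by simp)).1 h3

/-- If the convolutions are tight, then the left factors are tight after suitable shifts. -/
theorem exists_isTightMeasureSet_conv_dirac {ι : Type*} {A B : ι → Measure E}
    [∀ i, IsProbabilityMeasure (A i)] [∀ i, IsProbabilityMeasure (B i)]
    (hAB : IsTightMeasureSet (Set.range fun i => A i ∗ B i)) :
    ∃ a : ι → E, IsTightMeasureSet (Set.range fun i => A i ∗ Measure.dirac (a i)) := by
  rw [isTightMeasureSet_range_iff] at hAB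
  obtain ⟨e, he, hsum⟩ := ENNReal.exists_pos_sum_of_countable' one_ne_zero ℕ
  have htop : ∀ n, e n ≠ ∞ := fun n =>
    ((ENNReal.le_tsum n).trans_lt (hsum.trans ENNReal.one_lt_top)).ne
  -- With the tail bounded by `e n` squared, Markov's inequality leaves `B i`-mass at most `e n` of
  -- bad shifts at level `n`. As the `e n` sum to less than 1, some shift is good at all levels.
  choose R hR using fun n => hAB (e n * e n) (ENNReal.mul_pos (he n).ne' (he n).ne')
  have hmeas : ∀ i n, Measurable fun y => A i {x | R n < ‖x + y‖} := fun i n =>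
    measurable_measure_prodMk_right (s := {p : E × E | R n < ‖p.1 + p.2‖})
      (measurableSet_lt measurable_const (by fun_prop))
  have key : ∀ i, ∃ y : E, ∀ n, A i {x | R n < ‖x + y‖} < e n := by
    intro i
    by_contra! hcon
    have hle : ∀ n, B i {y | e n ≤ A i {x | R n < ‖x + y‖}} ≤ e n := by
      intro n
      have h1 := mul_meas_ge_le_lintegral (μ := B i) (hmeas i n) (e n)
      have h2 : ∫⁻ y, A i {x | R n < ‖x + y‖} ∂(B i) = (A i ∗ B i) {x | R n < ‖x‖} := by
        rw [Measure.conv, Measure.map_apply measurable_add (measurableSet_norm_gt _),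
          Measure.prod_apply_symm (measurable_add (measurableSet_norm_gt _))]
        rfl
      rw [h2] at h1
      exact (ENNReal.mul_le_mul_iff_right (he n).ne' (htop n)).1 (h1.trans (hR n i))
    have huniv : (Set.univ : Set E) ⊆ ⋃ n, {y | e n ≤ A i {x | R n < ‖x + y‖}} :=
      fun y _ => Set.mem_iUnion.2 (hcon y)
    have : (1 : ℝ≥0∞) ≤ ∑' n, e n := by
      calc (1 : ℝ≥0∞) = B i Set.univ := measure_univ.symm
        _ ≤ _ := measure_mono huniv
        _ ≤ _ := measure_iUnion_le _
        _ ≤ _ := ENNReal.tsum_le_tsum hle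
    exact absurd hsum this.not_gt
  choose a ha using key
  refine ⟨a, isTightMeasureSet_range_iff.2 fun ε hε => ?_⟩
  obtain ⟨n, hn⟩ := ((ENNReal.tendsto_atTop_zero_of_tsum_ne_top
    (hsum.trans ENNReal.one_lt_top).ne).eventually (gt_mem_nhds hε)).exists
  refine ⟨R n, fun i => ?_⟩
  rw [Measure.conv_dirac, Measure.map_apply (by fun_prop) (measurableSet_norm_gt _)]
  exact ((ha i n).trans hn).le

/-- Tight families of probability measures have limits along ultrafilters, in the sense of
pointwise convergence of characteristic functions. -/
theorem exists_tendsto_charFun_of_isTightMeasureSet {ι : Type*} {A : ι → Measure E}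
    [hA : ∀ i, IsProbabilityMeasure (A i)] (U : Ultrafilter ι) {s : Set ι} (hs : s ∈ U)
    (htight : IsTightMeasureSet (Set.range fun i : s => A i)) :
    ∃ π : Measure E, IsProbabilityMeasure π ∧
      ∀ t, Tendsto (fun i => charFun (A i) t) U (𝓝 (charFun π t)) := by
  have : ProperSpace E := FiniteDimensional.proper ℝ E
  let p : ι → ProbabilityMeasure E := fun i => ⟨A i, hA i⟩
  have hc : IsCompact (closure (p '' s)) := by
    refine isCompact_closure_of_isTightMeasureSet (htight.subset ?_)
    rintro _ ⟨_, ⟨i, hi, rfl⟩, rfl⟩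
    exact ⟨⟨i, hi⟩, rfl⟩
  obtain ⟨π, -, hπ⟩ := hc.ultrafilter_le_nhds (U.map p) (le_principal_iff.2
    (mem_of_superset (image_mem_map hs) subset_closure))
  refine ⟨π, inferInstance, fun t => ?_⟩
  have hT : Tendsto p U (𝓝 π) := hπ
  rw [ProbabilityMeasure.tendsto_iff_forall_integral_rclike_tendsto ℂ] at hT
  simp_rw [charFun_eq_integral_innerProbChar]
  exact hT (BoundedContinuousFunction.innerProbChar t)

/-- A probability measure whose characteristic function is `1` near `0` is the Dirac mass at `0`. -/
theorem eq_dirac_zero_of_charFun_eventually_eq_one {θ : Measure E} [IsProbabilityMeasure θ]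
    (h : ∀ᶠ t in 𝓝 (0 : E), charFun θ t = 1) : θ = Measure.dirac 0 := by
  refine Measure.ext_of_charFun (funext fun t => ?_)
  have hlim : Tendsto (fun n : ℕ => ((n : ℝ) + 1)⁻¹ • t) atTop (𝓝 0) := by
    have := (tendsto_one_div_add_atTop_nhds_zero_nat (𝕜 := ℝ)).smul_const t
    simpa using this
  -- At `s = t / (n + 1)`, close to `0`, the value 1 forces the phase to be trivial almost surely;
  -- its `(n + 1)`-st power is then trivial at `t`.
  obtain ⟨n, hn⟩ := (hlim.eventually h).exists
  set s := ((n : ℝ) + 1)⁻¹ • t with hs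
  have hint : Integrable (fun x : E => Complex.exp (⟪x, s⟫ * Complex.I)) θ := by
    refine Integrable.of_bound (C := 1) (by fun_prop) (ae_of_all _ fun x => ?_)
    rw [Complex.norm_exp_ofReal_mul_I]
  have hcos : Integrable (fun x : E => Real.cos ⟪x, s⟫) θ := by
    simpa [Complex.exp_ofReal_mul_I_re] using hint.re
  have hre : ∫ x, (1 - Real.cos ⟪x, s⟫) ∂θ = 0 := by
    have h1 : ∫ x, Real.cos ⟪x, s⟫ ∂θ = 1 := by
      have := integral_re hint
      rw [← charFun_apply, hn] at this
      simpa [Complex.exp_ofReal_mul_I_re] using this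
    rw [integral_sub (integrable_const _) hcos, h1]
    simp
  have hae : ∀ᵐ x ∂θ, Real.cos ⟪x, s⟫ = 1 := by
    rw [integral_eq_zero_iff_of_nonneg (fun x => sub_nonneg.2 (Real.cos_le_one _))] at hre
    · filter_upwards [hre] with x hx
      exact (sub_eq_zero.1 hx).symm
    · exact (integrable_const _).sub hcos
  have ht : ∀ x : E, ⟪x, t⟫ = ((n + 1 : ℕ) : ℝ) * ⟪x, s⟫ := by
    intro x
    rw [hs, real_inner_smul_right]
    push_cast
    field_simp
  rw [charFun_apply, charFun_dirac]
  have hexp : (fun x : E => Complex.exp (⟪x, t⟫ * Complex.I)) =ᵐ[θ] fun _ => 1 := by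
    filter_upwards [hae] with x hx
    have hsin : Real.sin ⟪x, s⟫ = 0 := by
      have := Real.sin_sq_add_cos_sq ⟪x, s⟫
      rw [hx] at this
      simpa using this
    have h1 : Complex.exp (⟪x, s⟫ * Complex.I) = 1 := by
      rw [Complex.exp_mul_I, ← Complex.ofReal_cos, ← Complex.ofReal_sin, hx, hsin]
      simp
    rw [ht, Complex.ofReal_mul, mul_assoc, Complex.ofReal_natCast, Complex.exp_nat_mul, h1, one_pow]
  rw [integral_congr_ae hexp]
  simp

/-- If `lam * θ = lam`, then `θ` is the Dirac mass at `0`. -/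
theorem eq_dirac_zero_of_conv_eq_self {lam θ : Measure E} [IsProbabilityMeasure lam]
    [IsProbabilityMeasure θ] (h : lam ∗ θ = lam) : θ = Measure.dirac 0 := by
  refine eq_dirac_zero_of_charFun_eventually_eq_one ?_
  have h0 : charFun lam 0 ≠ 0 := by simp
  -- `charFun lam` may vanish far from `0`, so it can be cancelled only near `0`.
  filter_upwards [(continuous_charFun (μ := lam)).continuousAt.eventually_ne h0] with t ht
  have := charFun_conv (μ := lam) (ν := θ) t
  rw [h] at this
  exact mul_left_cancel₀ ht (by rw [← this, mul_one])

/-- A convolution factor of the Dirac mass at `0` is a Dirac mass. -/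
theorem exists_eq_dirac_of_conv_eq_dirac_zero {κ ν : Measure E} [IsProbabilityMeasure κ]
    [IsProbabilityMeasure ν] (h : κ ∗ ν = Measure.dirac 0) : ∃ c, ν = Measure.dirac c := by
  have hms : MeasurableSet ({0}ᶜ : Set E) := (measurableSet_singleton 0).compl
  have h0 : (κ ∗ ν) {0}ᶜ = 0 := by rw [h, Measure.dirac_apply' _ hms]; simp
  rw [Measure.conv, Measure.map_apply measurable_add hms,
    Measure.measure_prod_null (measurable_add hms)] at h0
  -- By Fubini, `ν` is carried by the point `-x` for almost every `x`; one such `x` suffices.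
  obtain ⟨x, hx⟩ := h0.exists
  refine ⟨-x, ?_⟩
  have hae : ∀ᵐ y ∂ν, y = -x := by
    rw [ae_iff]
    refine Eq.trans (congrArg ν ?_) hx
    ext y
    simp [eq_neg_iff_add_eq_zero, add_comm]
  refine Measure.ext_of_charFun (funext fun t => ?_)
  rw [charFun_apply, charFun_dirac, integral_congr_ae (g := fun _ => Complex.exp (⟪-x, t⟫ * Complex.I))
    (by filter_upwards [hae] with y hy; rw [hy])]
  simp

end Convolution

/-! ### Infinite divisibility: stability and closure under limits -/

section InfinitelyDivisible

variable {d : ℕ}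

instance isProbabilityMeasure_convPow (ρ : Measure (EuclideanSpace ℝ (Fin d)))
    [IsProbabilityMeasure ρ] (n : ℕ) : IsProbabilityMeasure (convPow ρ n) := by
  induction n with
  | zero => exact Measure.dirac.isProbabilityMeasure
  | succ n ih => rw [convPow]; infer_instance

theorem charFun_convPow (ρ : Measure (EuclideanSpace ℝ (Fin d))) [IsProbabilityMeasure ρ] (n : ℕ)
    (t : EuclideanSpace ℝ (Fin d)) : charFun (convPow ρ n) t = charFun ρ t ^ n := by
  induction n with
  | zero => simp [convPow, charFun_dirac]
  | succ n ih => rw [convPow, charFun_conv, ih, pow_succ]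

theorem IsInfinitelyDivisible.conv {ρ σ : Measure (EuclideanSpace ℝ (Fin d))}
    (hρ : IsInfinitelyDivisible ρ) (hσ : IsInfinitelyDivisible σ) :
    IsInfinitelyDivisible (ρ ∗ σ) := by
  have := hρ.1
  have := hσ.1
  refine ⟨inferInstance, fun n hn => ?_⟩
  obtain ⟨α, hα, rfl⟩ := hρ.2 n hn
  obtain ⟨β, hβ, rfl⟩ := hσ.2 n hn
  refine ⟨α ∗ β, inferInstance, Measure.ext_of_charFun (funext fun t => ?_)⟩
  simp only [charFun_convPow, charFun_conv, mul_pow]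

theorem isInfinitelyDivisible_dirac (a : EuclideanSpace ℝ (Fin d)) :
    IsInfinitelyDivisible (Measure.dirac a) := by
  refine ⟨inferInstance, fun n hn => ⟨Measure.dirac ((n : ℝ)⁻¹ • a), inferInstance,
    Measure.ext_of_charFun (funext fun t => ?_)⟩⟩
  have hn' : (n : ℂ) ≠ 0 := by exact_mod_cast (by omega : n ≠ 0)
  rw [charFun_convPow, charFun_dirac, charFun_dirac, ← Complex.exp_nat_mul, real_inner_smul_left]
  congr 1
  push_cast
  field_simp

theorem IsInfinitelyDivisible.map {ρ : Measure (EuclideanSpace ℝ (Fin d))}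
    (hρ : IsInfinitelyDivisible ρ)
    (L : EuclideanSpace ℝ (Fin d) →L[ℝ] EuclideanSpace ℝ (Fin d)) :
    IsInfinitelyDivisible (ρ.map L) := by
  have := hρ.1
  have hL : Measurable L := L.continuous.measurable
  refine ⟨Measure.isProbabilityMeasure_map hL.aemeasurable, fun n hn => ?_⟩
  obtain ⟨σ, hσ, rfl⟩ := hρ.2 n hn
  refine ⟨σ.map L, Measure.isProbabilityMeasure_map hL.aemeasurable, ?_⟩
  clear hn hρ this
  induction n with
  | zero => simp [convPow, Measure.map_dirac' hL]
  | succ n ih => rw [convPow, convPow, ih, Measure.map_conv_continuousLinearMap]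

/-- If all `n` summands lie in a half-space, so does their sum, at `n` times the level. This lets
tails of a power control those of its root. -/
theorem pow_measure_le_convPow (σ : Measure (EuclideanSpace ℝ (Fin d))) [IsProbabilityMeasure σ]
    (y : EuclideanSpace ℝ (Fin d)) (r : ℝ) (n : ℕ) :
    σ {x | r < ⟪y, x⟫} ^ n ≤ convPow σ n {x | n * r ≤ ⟪y, x⟫} := by
  induction n with
  | zero => simp [convPow]
  | succ n ih =>
    rw [pow_succ, convPow]
    refine (mul_le_mul_left ih _).trans (mul_le_conv_apply ?_ fun x hx z hz => ?_)
    · exact measurableSet_le measurable_const (by fun_prop)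
    · simp only [Set.mem_ofPred_eq, inner_add_right] at *
      push_cast
      linarith

/-- If the `n`-fold convolution powers are tight, `n ≥ 1`, then so are the measures. -/
theorem isTightMeasureSet_of_convPow {ι : Type*} {σ : ι → Measure (EuclideanSpace ℝ (Fin d))}
    [∀ i, IsProbabilityMeasure (σ i)] {n : ℕ} (hn : 1 ≤ n)
    (h : IsTightMeasureSet (Set.range fun i => convPow (σ i) n)) :
    IsTightMeasureSet (Set.range σ) := by
  refine isTightMeasureSet_of_inner_tendsto ℝ fun y => ?_
  rw [isTightMeasureSet_iff_inner_tendsto ℝ] at h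
  specialize h y
  rw [ENNReal.tendsto_atTop_zero] at h ⊢
  simp only [iSup_range, iSup_le_iff] at h ⊢
  intro ε hε
  have hn0 : n ≠ 0 := by omega
  -- Taking `n`-th roots gives `ε / 2` for each of the two opposite half-spaces.
  obtain ⟨R, hR⟩ := h ((ε / 2) ^ n) (pos_iff_ne_zero.2 (pow_ne_zero n (ENNReal.half_pos hε.ne').ne'))
  have hR' : ∀ i, convPow (σ i) n {x | |R| < ‖⟪y, x⟫‖} ≤ (ε / 2) ^ n := hR _ (le_abs_self R)
  refine ⟨|R| + 1, fun r hr i => ?_⟩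
  have hnr : |R| < n * r := by
    have : (1 : ℝ) ≤ n := by exact_mod_cast hn
    nlinarith [abs_nonneg R]
  have hside : ∀ z : EuclideanSpace ℝ (Fin d), (∀ x, |⟪z, x⟫| = |⟪y, x⟫|) →
      σ i {x | r < ⟪z, x⟫} ≤ ε / 2 := by
    intro z hz
    refine (ENNReal.pow_le_pow_left_iff hn0).1 ((pow_measure_le_convPow (σ i) z r n).trans
      ((measure_mono fun x hx => ?_).trans (hR' i)))
    simp only [Set.mem_ofPred_eq, Real.norm_eq_abs] at hx ⊢
    rw [← hz]
    exact hnr.trans_le (hx.trans (le_abs_self _))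
  calc σ i {x | r < ‖⟪y, x⟫‖} ≤ σ i ({x | r < ⟪y, x⟫} ∪ {x | r < ⟪-y, x⟫}) := by
        refine measure_mono fun x hx => ?_
        simpa [lt_abs, inner_neg_left] using hx
    _ ≤ σ i {x | r < ⟪y, x⟫} + σ i {x | r < ⟪-y, x⟫} := measure_union_le _ _
    _ ≤ ε / 2 + ε / 2 := add_le_add (hside y fun _ => rfl) (hside (-y) fun x => by simp)
    _ = ε := ENNReal.add_halves ε

/-- Limits of infinitely divisible measures are infinitely divisible. -/
theorem IsInfinitelyDivisible.of_tendsto_charFun {ι : Type*}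
    {ρ : ι → Measure (EuclideanSpace ℝ (Fin d))} (hρ : ∀ i, IsInfinitelyDivisible (ρ i))
    (U : Ultrafilter ι) {s : Set ι} (hs : s ∈ U)
    (htight : IsTightMeasureSet (Set.range fun i : s => ρ i))
    {π : Measure (EuclideanSpace ℝ (Fin d))} [IsProbabilityMeasure π]
    (hπ : ∀ t, Tendsto (fun i => charFun (ρ i) t) U (𝓝 (charFun π t))) :
    IsInfinitelyDivisible π := by
  refine ⟨inferInstance, fun n hn => ?_⟩
  choose σ hσ hσρ using fun i => (hρ i).2 n hn
  have ht : IsTightMeasureSet (Set.range fun i : s => σ i) :=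
    isTightMeasureSet_of_convPow hn (by simpa only [hσρ] using htight)
  obtain ⟨τ, hτ, hlim⟩ := exists_tendsto_charFun_of_isTightMeasureSet U hs ht
  refine ⟨τ, hτ, Measure.ext_of_charFun (funext fun t => ?_)⟩
  rw [charFun_convPow]
  refine tendsto_nhds_unique ((hlim t).pow n) ?_
  simpa only [← hσρ, charFun_convPow] using hπ t

end InfinitelyDivisible

/-! ### The equation without `φ` -/

section Evolution

variable {d : ℕ}

/-- The convolution `η (l + n) * ⋯ * η (l + 1)`. -/
noncomputable def convBlock (η : ℤ → Measure (EuclideanSpace ℝ (Fin d))) (l : ℤ) :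
    ℕ → Measure (EuclideanSpace ℝ (Fin d))
  | 0 => Measure.dirac 0
  | n + 1 => η (l + n + 1) ∗ convBlock η l n

theorem isInfinitelyDivisible_convBlock {η : ℤ → Measure (EuclideanSpace ℝ (Fin d))}
    (hη : ∀ k, IsInfinitelyDivisible (η k)) (l : ℤ) (n : ℕ) :
    IsInfinitelyDivisible (convBlock η l n) := by
  induction n with
  | zero => exact isInfinitelyDivisible_dirac 0
  | succ n ih => exact (hη _).conv ih

theorem eq_convBlock_conv {η lam : ℤ → Measure (EuclideanSpace ℝ (Fin d))}
    (hη : ∀ k, IsInfinitelyDivisible (η k)) (hp : ∀ k, IsProbabilityMeasure (lam k))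
    (hlam : ∀ k, lam k = η k ∗ lam (k - 1)) (l : ℤ) (n : ℕ) :
    lam (l + n) = convBlock η l n ∗ lam l := by
  have := fun n => (isInfinitelyDivisible_convBlock hη l n).1
  induction n with
  | zero => simp [convBlock]
  | succ n ih =>
    rw [convBlock, Measure.conv_assoc, ← ih, hlam]
    push_cast
    congr 2 <;> omega

/-- A solution of `lam k = η k * lam (k - 1)` that divides every other solution is infinitely
divisible when the `η k` are. -/
theorem isInfinitelyDivisible_of_divides_solutions
    {η lam : ℤ → Measure (EuclideanSpace ℝ (Fin d))}
    (hη : ∀ k, IsInfinitelyDivisible (η k)) (hp : ∀ k, IsProbabilityMeasure (lam k))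
    (hlam : ∀ k, lam k = η k ∗ lam (k - 1))
    (hfund : ∀ ν : ℤ → Measure (EuclideanSpace ℝ (Fin d)), (∀ k, IsProbabilityMeasure (ν k)) →
      (∀ k, ν k = η k ∗ ν (k - 1)) → ∃ ρ : Measure (EuclideanSpace ℝ (Fin d)),
        IsProbabilityMeasure ρ ∧ ∀ k, ν k = lam k ∗ ρ) (k : ℤ) :
    IsInfinitelyDivisible (lam k) := by
  have := fun k => (hη k).1
  -- For `k < -m` the truncation `toNat` makes this the Dirac mass at `0`; only large `m` matter.
  let P : ℤ → ℕ → Measure (EuclideanSpace ℝ (Fin d)) := fun k m =>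
    convBlock η (-m) (k + m).toNat
  have hPid : ∀ k m, IsInfinitelyDivisible (P k m) := fun k m =>
    isInfinitelyDivisible_convBlock hη _ _
  have hPp : ∀ k m, IsProbabilityMeasure (P k m) := fun k m => (hPid k m).1
  have hP : ∀ (k : ℤ) (m : ℕ), 0 ≤ k + m → lam k = P k m ∗ lam (-m) := by
    intro k m hkm
    rw [← eq_convBlock_conv hη hp hlam, Int.toNat_of_nonneg hkm]
    congr 1; ring
  have hPsucc : ∀ (k : ℤ) (m : ℕ), 0 < k + m → P k m = η k ∗ P (k - 1) m := by
    intro k m hkm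
    obtain ⟨n, hn⟩ : ∃ n : ℕ, k + m = n + 1 := ⟨(k + m - 1).toNat, by omega⟩
    have h1 : (k + m).toNat = n + 1 := by omega
    have h2 : (k - 1 + m).toNat = n := by omega
    simp only [P, h1, h2, convBlock]
    congr 2; omega
  have hsing : ∀ (ι : Type) (k : ℤ), IsTightMeasureSet (Set.range fun _ : ι => lam k) :=
    fun ι k => isTightMeasureSet_singleton.subset Set.range_const_subset
  -- The shifts are chosen at `k = 0` and used for every `k`, so that the recursion survives in the
  -- limit.
  obtain ⟨a, ha⟩ := exists_isTightMeasureSet_conv_dirac (A := P 0) (B := fun m : ℕ => lam (-m))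
    (by
      have : (fun m : ℕ => P 0 m ∗ lam (-m)) = fun _ => lam 0 :=
        funext fun m => (hP 0 m (by omega)).symm
      exact this ▸ hsing ℕ 0)
  let A : ℤ → ℕ → Measure (EuclideanSpace ℝ (Fin d)) := fun k m => P k m ∗ Measure.dirac (a m)
  let B : ℕ → Measure (EuclideanSpace ℝ (Fin d)) := fun m => lam (-m) ∗ Measure.dirac (-a m)
  have hAid : ∀ k m, IsInfinitelyDivisible (A k m) := fun k m =>
    (hPid k m).conv (isInfinitelyDivisible_dirac _)
  have hAp : ∀ k m, IsProbabilityMeasure (A k m) := fun k m => (hAid k m).1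
  have hBp : ∀ m, IsProbabilityMeasure (B m) := fun m => by dsimp only [B]; infer_instance
  have hAB : ∀ (k : ℤ) (m : ℕ), 0 ≤ k + m → lam k = A k m ∗ B m := by
    intro k m hkm
    refine Measure.ext_of_charFun (funext fun t => ?_)
    have h1 := charFun_dirac (x := a m) t
    have h2 := charFun_dirac (x := -a m) t
    have h3 : charFun (Measure.dirac (a m)) t * charFun (Measure.dirac (-a m)) t = 1 := by
      rw [h1, h2, ← Complex.exp_add]; simp
    rw [hP k m hkm]
    simp only [A, B, charFun_conv]
    linear_combination (-charFun (P k m) t * charFun (lam (-m)) t) * h3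
  have hAsucc : ∀ (k : ℤ) (m : ℕ), 0 < k + m → A k m = η k ∗ A (k - 1) m := by
    intro k m hkm
    simp only [A, hPsucc k m hkm, Measure.conv_assoc]
  have hBt : IsTightMeasureSet (Set.range B) := by
    refine IsTightMeasureSet.right_of_conv ha ?_
    have : (fun m : ℕ => A 0 m ∗ B m) = fun _ => lam 0 :=
      funext fun m => (hAB 0 m (by omega)).symm
    exact this ▸ hsing ℕ 0
  let s : ℤ → Set ℕ := fun k => {m | 0 < k + m}
  -- Tightness passes from `A 0` to `B`, and from `B` back to every `A k`.
  have hAt : ∀ k, IsTightMeasureSet (Set.range fun m : s k => A k m) := by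
    intro k
    refine IsTightMeasureSet.right_of_conv (A := fun m : s k => B m)
      (hBt.subset (by rintro _ ⟨m, rfl⟩; exact ⟨m, rfl⟩)) ?_
    have : (fun m : s k => B m ∗ A k m) = fun _ => lam k :=
      funext fun m => by rw [Measure.conv_comm, ← hAB k m (le_of_lt m.2)]
    exact this ▸ hsing (s k) k
  -- One ultrafilter serves all `k` at once, in place of a diagonal subsequence.
  let U : Ultrafilter ℕ := Ultrafilter.of atTop
  have hs : ∀ k, s k ∈ U := fun k => Ultrafilter.of_le _ (by
    filter_upwards [eventually_gt_atTop (-k).toNat] with m hm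
    simp only [s, Set.mem_ofPred_eq]; omega)
  choose π hπp hπ using fun k => exists_tendsto_charFun_of_isTightMeasureSet U (hs k) (hAt k)
  obtain ⟨κ, hκp, hκ⟩ := exists_tendsto_charFun_of_isTightMeasureSet (A := B) U (s := Set.univ)
    univ_mem (hBt.subset (by rintro _ ⟨m, rfl⟩; exact ⟨m, rfl⟩))
  have hπid : ∀ k, IsInfinitelyDivisible (π k) := fun k =>
    IsInfinitelyDivisible.of_tendsto_charFun (hAid k) U (hs k) (hAt k) (hπ k)
  have hπsol : ∀ k, π k = η k ∗ π (k - 1) := by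
    intro k
    refine Measure.ext_of_charFun (funext fun t => ?_)
    rw [charFun_conv]
    refine tendsto_nhds_unique (hπ k t) (((hπ (k - 1) t).const_mul _).congr' ?_)
    filter_upwards [hs k] with m hm
    rw [hAsucc k m hm]
    exact (charFun_conv t).symm
  have hπκ : lam k = π k ∗ κ := by
    refine Measure.ext_of_charFun (funext fun t => ?_)
    rw [charFun_conv]
    refine tendsto_nhds_unique (tendsto_const_nhds (f := (U : Filter ℕ)))
      (((hπ k t).mul (hκ t)).congr' ?_)
    filter_upwards [hs k] with m hm
    rw [hAB k m (le_of_lt hm)]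
    exact (charFun_conv t).symm
  obtain ⟨ν, hνp, hν⟩ := hfund π hπp hπsol
  have hself : lam k ∗ (κ ∗ ν) = lam k := by
    conv_rhs => rw [hπκ, hν k, Measure.conv_assoc, Measure.conv_comm ν κ]
  obtain ⟨c, rfl⟩ := exists_eq_dirac_of_conv_eq_dirac_zero (eq_dirac_zero_of_conv_eq_self hself)
  have hback : lam k = π k ∗ Measure.dirac (-c) := by
    rw [hν k, Measure.conv_assoc, Measure.dirac_conv_dirac]
    simp
  rw [hback]
  exact (hπid k).conv (isInfinitelyDivisible_dirac _)

end Evolution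

/-! ### Removing `φ` by a change of variables -/

theorem mainTheorem8 (d : ℕ) (μ : ℤ → Measure (EuclideanSpace ℝ (Fin d)))
    (φ : EuclideanSpace ℝ (Fin d) ≃ₗ[ℝ] EuclideanSpace ℝ (Fin d))
    (hμ : ∀ k : ℤ, IsInfinitelyDivisible (μ k))
    (lam : ℤ → Measure (EuclideanSpace ℝ (Fin d)))
    (hlam : IsFundamentalSolution μ φ lam) :
    ∀ k : ℤ, IsInfinitelyDivisible (lam k) := by
  obtain ⟨⟨hp, hsol⟩, hfund⟩ := hlam
  have hμp := fun k => (hμ k).1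
  let L : ℤ → (EuclideanSpace ℝ (Fin d) →L[ℝ] EuclideanSpace ℝ (Fin d)) := fun k =>
    LinearMap.toContinuousLinearMap ((φ ^ k : _ ≃ₗ[ℝ] _) : _ →ₗ[ℝ] _)
  have hLm : ∀ k, Measurable (L k) := fun k => (L k).continuous.measurable
  have hLφ : ∀ k, ⇑(L k) = ⇑(φ ^ k) := fun k => rfl
  have hL1 : ⇑(L 1) = ⇑φ := by rw [hLφ, zpow_one]
  have hLL : ∀ (i j : ℤ) (ρ : Measure (EuclideanSpace ℝ (Fin d))),
      (ρ.map (L j)).map (L i) = ρ.map (L (i + j)) := by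
    intro i j ρ
    rw [Measure.map_map (hLm i) (hLm j)]
    congr 1
    simp only [hLφ, zpow_add]
    rfl
  have hL0 : ∀ ρ : Measure (EuclideanSpace ℝ (Fin d)), ρ.map (L 0) = ρ := by
    intro ρ
    have : ⇑(L 0) = id := by rw [hLφ, zpow_zero]; rfl
    rw [this, Measure.map_id]
  have hLp : ∀ (i : ℤ) (ρ : Measure (EuclideanSpace ℝ (Fin d))) [IsProbabilityMeasure ρ],
      IsProbabilityMeasure (ρ.map (L i)) := fun i ρ _ =>
    Measure.isProbabilityMeasure_map (hLm i).aemeasurable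
  intro k
  have key : IsInfinitelyDivisible ((lam k).map (L (-k))) := by
    refine isInfinitelyDivisible_of_divides_solutions (η := fun k => (μ k).map (L (-k)))
      (lam := fun k => (lam k).map (L (-k))) (fun k => (hμ k).map _) (fun k => hLp _ _)
      (fun k => ?_) (fun ν hνp hν => ?_) k
    · have := hLp 1 (lam (k - 1))
      rw [← hL1] at hsol
      conv_lhs => rw [hsol k, Measure.map_conv_continuousLinearMap, hLL]
      rw [show -k + 1 = -(k - 1) by ring]
    · have hsol' : IsConvSolution μ φ fun k => (ν k).map (L k) := by
        refine ⟨fun k => hLp _ _, fun k => ?_⟩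
        have := hLp (-k) (μ k)
        beta_reduce
        conv_lhs => rw [hν k, Measure.map_conv_continuousLinearMap, hLL, add_neg_cancel, hL0]
        rw [← hL1, hLL, add_sub_cancel]
      obtain ⟨ρ, hρ, h⟩ := hfund _ hsol'
      refine ⟨ρ, hρ, fun k => ?_⟩
      have := hLp k ρ
      have hk := congrArg (Measure.map (L (-k))) (h k)
      rwa [← hLφ, Measure.map_conv_continuousLinearMap, hLL, hLL, neg_add_cancel, hL0, hL0] at hk
  have := key.map (L k)
  rwa [hLL, add_neg_cancel, hL0] at this
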